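/- Let $n\ge 0$, let $T$ be a compact metric space, let $f:\mathbb{R}^n\to\mathbb{R}$ and $g_t:\mathbb{R}^n\to\mathbb{R}$ ($t\in T$) be convex functions such that $(t,x)\mapsto g_t(x)$ is continuous on $T\times\mathbb{R}^n$, and let $q\in(0,1]$. For $c\in\mathbb{R}^n$ and $b\in C(T,\mathbb{R})$ consider the problem $$P(c,b):\quad \text{minimize } f(x)+\langle c,x\rangle \quad\text{subject to } g_t(x)\le b_t,\ t\in T .$$ Let $\mathcal{S}(c,b)\subset\mathbb{R}^n$ be its set of global minimizers, and put $\mathcal{S}_c(b):=\mathcal{S}(c,b)$. Here $\mathbb{R}^n$ carries the Euclidean norm, $C(T,\mathbb{R})$ the norm $\|b\|_\infty=\sup_{t\in T}|b_t|$, and products carry the maximum norm. A set-valued mapping $S:Y\rightrightarrows X$ between metric spaces is called *$q$-order calm* at a point $(\bar y,\bar x)$ of its graph if there are $\tau>0$ and neighborhoods $U$ of $\bar x$ and $V$ of $\bar y$ such that $\tau\, d(x,S(\bar y))\le d(y,\bar y)^q$ for all $y\in V$ and $x\in S(y)\cap U$. A function $\varphi:X\to\mathbb{R}$ with $\varphi(\bar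 x)\le 0$ has a *$q$-order local error bound* at $\bar x$ if there are $\tau,\delta>0$ such that $\tau\, d(x,\{\varphi\le 0\})\le \max\{\varphi(x),0\}^q$ for all $x$ with $d(x,\bar x)<\delta$. **Theorem.** Let $\bar c\in\mathbb{R}^n$, $\bar b\in C(T,\mathbb{R})$ and $\bar x\in\mathcal{S}(\bar c,\bar b)$, and assume that $P(\bar c,\bar b)$ satisfies the Slater condition: there is $\hat x\in\mathbb{R}^n$ with $g_t(\hat x)<\bar b_t$ for all $t\in T$. Define $\mathcal{L}:\mathbb{R}\times C(T,\mathbb{R})\rightrightarrows\mathbb{R}^n$ and $\bar f:\mathbb{R}^n\to\mathbb{R}$ by $$\mathcal{L}(\alpha,b):=\{x\in\mathbb{R}^n \mid f(x)+\langle\bar c,x\rangle\le\alpha,\ g_t(x)\le b_t\ \text{for all } t\in T\},$$ $$\bar f(x):=\sup\{f(x)-f(\bar x)+\langle\bar c,x-\bar x\rangle;\ g_t(x)-\bar b_t,\ t\in T\}.$$ Consider the statements (i) $\mathcal{S}$ is $q$-order calm at $((\bar c,\bar b),\bar x)$; (ii) $\mathcal{S}_{\bar c}$ is $q$-order calm at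 $(\bar b,\bar x)$; (iii) $\mathcal{L}$ is $q$-order calm at $((f(\bar x)+\langle\bar c,\bar x\rangle,\bar b),\bar x)$; (iv) $\bar f$ has a $q$-order local error bound at $\bar x$. Then (iii) $\Leftrightarrow$ (iv) $\Rightarrow$ (i) $\Rightarrow$ (ii). If, in addition, $f$ and all $g_t$ are linear, then (i), (ii), (iii) and (iv) are all equivalent. -/

import Mathlib

open Set Filter Topology

namespace HolderCalm

noncomputable section

/-- `S : Y ⇉ X` is `q`-order calm at the point `(y₀, x₀)` of its graph.
Since `S y₀` contains `x₀`, the real-valued `Metric.infDist` is the true distance. -/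
def IsOrderCalm {Y X : Type*} [PseudoMetricSpace Y] [PseudoMetricSpace X]
    (q : ℝ) (S : Y → Set X) (y₀ : Y) (x₀ : X) : Prop :=
  x₀ ∈ S y₀ ∧ ∃ τ : ℝ, 0 < τ ∧ ∃ U ∈ 𝓝 x₀, ∃ V ∈ 𝓝 y₀,
    ∀ y ∈ V, ∀ x ∈ S y ∩ U, τ * Metric.infDist x (S y₀) ≤ dist y y₀ ^ q

/-- `φ` admits a `q`-order local error bound at the point `x₀` of `[φ ≤ 0]`.
Since `[φ ≤ 0]` contains `x₀`, the real-valued `Metric.infDist` is the true distance. -/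
def HasOrderErrorBound {X : Type*} [PseudoMetricSpace X]
    (q : ℝ) (φ : X → ℝ) (x₀ : X) : Prop :=
  φ x₀ ≤ 0 ∧ ∃ τ : ℝ, 0 < τ ∧ ∃ δ : ℝ, 0 < δ ∧
    ∀ x ∈ Metric.ball x₀ δ, τ * Metric.infDist x {z | φ z ≤ 0} ≤ max (φ x) 0 ^ q

variable {n : ℕ} {T : Type*} [TopologicalSpace T]

/-- The feasible set `𝓕(b) = {x | g_t(x) ≤ b_t for all t}`. -/
def feasibleSet (g : T → EuclideanSpace ℝ (Fin n) → ℝ) (b : C(T, ℝ)) :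
    Set (EuclideanSpace ℝ (Fin n)) :=
  {x | ∀ t, g t x ≤ b t}

/-- The argmin mapping `𝓢(c, b)`: the global minimizers of `f + ⟨c, ·⟩` on `𝓕(b)`. -/
def solutionMap (f : EuclideanSpace ℝ (Fin n) → ℝ) (g : T → EuclideanSpace ℝ (Fin n) → ℝ)
    (p : EuclideanSpace ℝ (Fin n) × C(T, ℝ)) : Set (EuclideanSpace ℝ (Fin n)) :=
  {x | x ∈ feasibleSet g p.2 ∧
    ∀ y ∈ feasibleSet g p.2, f x + inner ℝ p.1 x ≤ f y + inner ℝ p.1 y}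

/-- The partial argmin mapping `𝓢_c(b) = 𝓢(c, b)`, with `c` fixed. -/
def partialSolutionMap (f : EuclideanSpace ℝ (Fin n) → ℝ)
    (g : T → EuclideanSpace ℝ (Fin n) → ℝ) (c : EuclideanSpace ℝ (Fin n)) (b : C(T, ℝ)) :
    Set (EuclideanSpace ℝ (Fin n)) :=
  solutionMap f g (c, b)

/-- The level set mapping `𝓛(α, b) = {x | f(x) + ⟨c, x⟩ ≤ α, g_t(x) ≤ b_t for all t}`. -/
def levelSetMap (f : EuclideanSpace ℝ (Fin n) → ℝ) (g : T → EuclideanSpace ℝ (Fin n) → ℝ)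
    (c : EuclideanSpace ℝ (Fin n)) (p : ℝ × C(T, ℝ)) : Set (EuclideanSpace ℝ (Fin n)) :=
  {x | f x + inner ℝ c x ≤ p.1 ∧ ∀ t, g t x ≤ p.2 t}

/-- The supremum function
`x ↦ sup {f(x) - f(x₀) + ⟨c, x - x₀⟩; g_t(x) - b_t, t ∈ T}`. -/
def supFunction (f : EuclideanSpace ℝ (Fin n) → ℝ) (g : T → EuclideanSpace ℝ (Fin n) → ℝ)
    (c : EuclideanSpace ℝ (Fin n)) (b : C(T, ℝ)) (x₀ x : EuclideanSpace ℝ (Fin n)) : ℝ :=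
  sSup (insert (f x - f x₀ + inner ℝ c (x - x₀)) (range fun t => g t x - b t))

/-- The Slater condition: some point satisfies all the constraints strictly. -/
def SlaterCondition (g : T → EuclideanSpace ℝ (Fin n) → ℝ) (b : C(T, ℝ)) : Prop :=
  ∃ z, ∀ t, g t z < b t

end

end HolderCalm

/-!
The level set mapping at the reference parameter, the sublevel set `[f̄ ≤ 0]` of the supremum
function and the solution set all coincide, so every statement below estimates the distance to one
and the same set.

* A point `x` belongs to `𝓛(α₀ + r, b₀ + r)` exactly when `f̄ x ≤ r`, which makes calmness of `𝓛`
  and the error bound for `f̄` two readings of one inequality (`isOrderCalm_levelSetMap_iff`).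
* Under the Slater condition the optimal value grows at most linearly in the perturbation: moving `x₀`
  towards the Slater point by a fraction proportional to `‖b - b₀‖` yields a point feasible for `b`. Hence
  `f̄ x ≤ κ ‖(c, b) - (c₀, b₀)‖` for every solution `x ∈ 𝓢(c, b)` near `x₀`
  (`exists_supFunction_le_of_mem_solutionMap`), and the error bound yields calmness of `𝓢`.
* For linear data the Slater condition supplies Karush–Kuhn–Tucker multipliers at `x₀`
  (`exists_multipliers`), obtained by separating the origin from the convex hull of the
  compact set of gradients paired with slacks. Given `x ∈ 𝓛(α, b)`, put
  `b' = b₀ + max (g(x) - b₀) (-κ d)` with `d` the distance of the parameters. The multipliers keep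
  the residuals `g_t(x) - b₀ t` in their support above `-κ d`, so `x` is feasible for `b'` and active
  in those constraints. The same multipliers therefore certify that `x` is optimal
  for `b'`, and calmness of the partial solution mapping applies at `b'`.
-/

namespace HolderCalm

/-! ### Compactness of convex hulls -/

/-- By Carathéodory's theorem the convex hull is a finite union of continuous images of products of
a standard simplex with a power of the set. -/
theorem isCompact_convexHull_of_finiteDimensional {E : Type*} [NormedAddCommGroup E]
    [NormedSpace ℝ E] [FiniteDimensional ℝ E] {K : Set E} (hK : IsCompact K) :
    IsCompact (convexHull ℝ K) := by
  have hU : convexHull ℝ K = ⋃ k ∈ Finset.range (Module.finrank ℝ E + 2),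
      (fun p : (Fin k → ℝ) × (Fin k → E) => ∑ i, p.1 i • p.2 i) ''
        (stdSimplex ℝ (Fin k) ×ˢ Set.univ.pi fun _ => K) := by
    apply Subset.antisymm
    · intro x hx
      obtain ⟨ι, _, z, w, hz, hai, hw, hw1, hx⟩ := eq_pos_convex_span_of_mem_convexHull hx
      have hcard : Fintype.card ι ≤ Module.finrank ℝ E + 1 :=
        hai.card_le_finrank_succ.trans (by gcongr; exact Submodule.finrank_le _)
      let e := Fintype.equivFin ι
      refine mem_iUnion₂.2 ⟨Fintype.card ι, Finset.mem_range.2 (by omega),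
        (w ∘ e.symm, z ∘ e.symm), ⟨⟨fun i => (hw _).le, ?_⟩, fun i _ => hz (mem_range_self _)⟩, ?_⟩
      · rw [← hw1]
        exact e.symm.sum_comp w
      · rw [← hx]
        exact e.symm.sum_comp fun i => w i • z i
    · refine iUnion₂_subset fun k _ => ?_
      rintro _ ⟨⟨w, z⟩, ⟨hw, hz⟩, rfl⟩
      exact mem_convexHull_of_exists_fintype w z hw.1 hw.2 (fun i => hz i (mem_univ i)) rfl
  rw [hU]
  refine (Finset.range _).isCompact_biUnion fun k _ => ?_
  refine IsCompact.image ?_ (by fun_prop)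
  exact (isCompact_stdSimplex ℝ (Fin k)).prod (isCompact_univ_pi fun _ => hK)

/-! ### Multipliers for linear semi-infinite systems -/

/-- Fritz John condition: if `⟪c, ·⟫` is nonnegative on all `d` with `⟪a t, d⟫ ≤ s t`, where the
slacks `s t` are nonnegative, then the origin is a convex combination of `(c, 0)` and the pairs
`(a t, s t)`. -/
theorem zero_mem_convexHull_gradients {E T : Type*} [NormedAddCommGroup E] [InnerProductSpace ℝ E]
    [FiniteDimensional ℝ E] [TopologicalSpace T] [CompactSpace T] {a : T → E} {s : T → ℝ} {c : E}
    (ha : Continuous a) (hs : Continuous s) (hs0 : ∀ t, 0 ≤ s t)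
    (hc : ∀ d : E, (∀ t, inner ℝ (a t) d ≤ s t) → 0 ≤ inner ℝ c d) :
    (0 : E × ℝ) ∈ convexHull ℝ (insert (c, 0) (range fun t => (a t, s t))) := by
  have hcomp : IsCompact (insert ((c, 0) : E × ℝ) (range fun t => (a t, s t))) :=
    (isCompact_range (ha.prodMk hs)).insert _
  by_contra h0
  obtain ⟨φ, u, hlt, hu⟩ := geometric_hahn_banach_closed_point (convex_convexHull ℝ _)
    (isCompact_convexHull_of_finiteDimensional hcomp).isClosed h0
  rw [map_zero] at hu
  set d : E := (InnerProductSpace.toDual ℝ E).symm (φ.comp (ContinuousLinearMap.inl ℝ E ℝ)) with hd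
  set r : ℝ := φ (0, 1) with hr
  have hφ (v : E) (x : ℝ) : φ (v, x) = inner ℝ v d + x * r := by
    have h1 : inner ℝ v d = φ (v, 0) := by
      rw [real_inner_comm, hd, InnerProductSpace.toDual_symm_apply]
      simp
    have h2 : ((v, x) : E × ℝ) = (v, 0) + x • (0, 1) := by simp
    rw [h2, map_add, map_smul, h1, smul_eq_mul]
  have hneg (p : E × ℝ) (hp : p ∈ insert ((c, 0) : E × ℝ) (range fun t => (a t, s t))) :
      φ p < 0 := (hlt p (subset_convexHull ℝ _ hp)).trans hu
  have hcd := hneg _ (mem_insert _ _)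
  rw [hφ] at hcd
  -- A step of length `1 / (1 + |r|)` along `d` uses up at most the available slack.
  set σ : ℝ := (1 + |r|)⁻¹ with hσ
  have hσ0 : 0 < σ := by positivity
  have hσr : σ * (1 + |r|) = 1 := inv_mul_cancel₀ (by positivity)
  have := hc (σ • d) fun t => by
    have h1 := hneg _ (mem_insert_of_mem _ (mem_range_self t))
    rw [hφ] at h1
    rw [inner_smul_right]
    nlinarith [neg_abs_le r, hs0 t, mul_nonneg hσ0.le (hs0 t),
      mul_nonneg (mul_nonneg hσ0.le (hs0 t)) (by linarith [neg_abs_le r] : 0 ≤ r + |r|)]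
  rw [inner_smul_right] at this
  nlinarith

/-- Karush–Kuhn–Tucker multipliers: in the presence of a Slater direction `z` the coefficient of the
objective in `zero_mem_convexHull_gradients` cannot vanish, so it can be normalized to one. -/
theorem exists_multipliers {E T : Type*} [NormedAddCommGroup E] [InnerProductSpace ℝ E]
    [FiniteDimensional ℝ E] [TopologicalSpace T] [CompactSpace T] {a : T → E} {s : T → ℝ} {c z : E}
    (ha : Continuous a) (hs : Continuous s) (hs0 : ∀ t, 0 ≤ s t)
    (hc : ∀ d : E, (∀ t, inner ℝ (a t) d ≤ s t) → 0 ≤ inner ℝ c d)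
    (hz : ∀ t, inner ℝ (a t) z < s t) :
    ∃ (ι : Type) (_ : Fintype ι) (w : ι → ℝ) (p : ι → T), (∀ i, 0 ≤ w i) ∧
      (∀ i, w i * s (p i) = 0) ∧ ∀ d, inner ℝ c d + ∑ i, w i * inner ℝ (a (p i)) d = 0 := by
  have h0 := zero_mem_convexHull_gradients ha hs hs0 hc
  rcases isEmpty_or_nonempty T with hT | hT
  · have hc0 : c = 0 := by
      rw [range_eq_empty, insert_empty_eq, convexHull_singleton, mem_singleton_iff] at h0
      simpa using (congrArg Prod.fst h0).symm
    exact ⟨Empty, inferInstance, Empty.elim, fun i => i.elim, fun i => i.elim, fun i => i.elim,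
      fun d => by simp [hc0]⟩
  rw [convexHull_insert (range_nonempty _), mem_convexJoin] at h0
  obtain ⟨_, rfl, y, hy, α, β, hα, hβ, hαβ, hy0⟩ := h0
  obtain ⟨ι, _, w, v, hw, hw1, hv, rfl⟩ := mem_convexHull_iff_exists_fintype.1 hy
  choose p hp using hv
  have hv' : v = fun i => (a (p i), s (p i)) := funext fun i => (hp i).symm
  subst hv'
  have hE : α • c + β • ∑ i, w i • a (p i) = 0 := by
    simpa [Prod.fst_sum] using congrArg Prod.fst hy0
  have hR : β * ∑ i, w i * s (p i) = 0 := by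
    simpa [Prod.snd_sum] using congrArg Prod.snd hy0
  have hd (d : E) : α * inner ℝ c d + β * ∑ i, w i * inner ℝ (a (p i)) d = 0 := by
    have := congrArg (fun u => inner ℝ u d) hE
    simpa [inner_add_left, inner_smul_left, sum_inner] using this
  have hα0 : 0 < α := by
    refine hα.lt_of_ne' fun h => ?_
    have hβ1 : β = 1 := by linarith
    have h1 := hd z
    rw [h, hβ1] at h1
    rw [hβ1] at hR
    have h2 : ∑ i, w i * (s (p i) - inner ℝ (a (p i)) z) = 0 := by
      simp only [mul_sub, Finset.sum_sub_distrib]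
      linarith
    have h3 (i : ι) : w i = 0 := by
      have := (Finset.sum_eq_zero_iff_of_nonneg
        fun i _ => mul_nonneg (hw i) (sub_nonneg.2 (hz (p i)).le)).1 h2 i (Finset.mem_univ i)
      exact (mul_eq_zero.1 this).resolve_right (sub_pos.2 (hz _)).ne'
    simp [h3] at hw1
  refine ⟨ι, inferInstance, fun i => α⁻¹ * β * w i, p, fun i => ?_, fun i => ?_, fun d => ?_⟩
  · have := hw i
    positivity
  · rw [Finset.mul_sum] at hR
    have := (Finset.sum_eq_zero_iff_of_nonneg
      fun i _ => mul_nonneg hβ (mul_nonneg (hw i) (hs0 (p i)))).1 hR i (Finset.mem_univ i)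
    linear_combination α⁻¹ * this
  · have h1 : ∑ i, α⁻¹ * β * w i * inner ℝ (a (p i)) d
        = α⁻¹ * (β * ∑ i, w i * inner ℝ (a (p i)) d) := by
      simp only [Finset.mul_sum]
      exact Finset.sum_congr rfl fun i _ => by ring
    have h2 : α⁻¹ * α = 1 := inv_mul_cancel₀ hα0.ne'
    rw [h1]
    linear_combination α⁻¹ * hd d - inner ℝ c d * h2

/-- The Riesz representatives of a continuous family of linear functions depend continuously on the
parameter, since their coordinates are the values at the basis vectors. -/
theorem exists_gradient {n : ℕ} {T : Type*} [TopologicalSpace T]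
    {g : T → EuclideanSpace ℝ (Fin n) → ℝ}
    (hcont : Continuous fun p : T × EuclideanSpace ℝ (Fin n) => g p.1 p.2)
    (hg : ∀ t, IsLinearMap ℝ (g t)) :
    ∃ a : T → EuclideanSpace ℝ (Fin n), Continuous a ∧ ∀ t x, g t x = inner ℝ (a t) x := by
  refine ⟨fun t => ∑ i, g t (EuclideanSpace.single i 1) • EuclideanSpace.single i 1, ?_, ?_⟩
  · refine continuous_finsetSum _ fun i _ => ?_
    have hi : Continuous fun t => g t (EuclideanSpace.single i 1) :=
      hcont.comp (by fun_prop : Continuous fun t => (t, EuclideanSpace.single i (1 : ℝ)))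
    exact hi.smul continuous_const
  · intro t x
    have hx : x = ∑ i, x i • EuclideanSpace.single i (1 : ℝ) := by
      simpa using ((EuclideanSpace.basisFun (Fin n) ℝ).sum_repr x).symm
    have h1 : g t x = ∑ i, x i * g t (EuclideanSpace.single i 1) := by
      conv_lhs => rw [hx]
      refine (map_sum (IsLinearMap.mk' (g t) (hg t)) _ _).trans ?_
      exact Finset.sum_congr rfl fun i _ => (hg t).map_smul _ _
    rw [h1, sum_inner]
    refine Finset.sum_congr rfl fun i _ => ?_
    simp [inner_smul_left, EuclideanSpace.inner_single_left, mul_comm]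

/-! ### Level sets and the supremum function -/

section

variable {n : ℕ} {T : Type*} [TopologicalSpace T]
  {f : EuclideanSpace ℝ (Fin n) → ℝ} {g : T → EuclideanSpace ℝ (Fin n) → ℝ}
  {c₀ x₀ : EuclideanSpace ℝ (Fin n)} {b₀ : C(T, ℝ)} {q : ℝ}

theorem levelSetMap_eq_solutionMap (hx₀ : x₀ ∈ solutionMap f g (c₀, b₀)) :
    levelSetMap f g c₀ (f x₀ + inner ℝ c₀ x₀, b₀) = solutionMap f g (c₀, b₀) := by
  ext x
  exact ⟨fun h => ⟨h.2, fun y hy => h.1.trans (hx₀.2 y hy)⟩, fun h => ⟨h.2 x₀ hx₀.1, h.1⟩⟩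

theorem mem_levelSetMap_of_mem_solutionMap (hx₀ : x₀ ∈ solutionMap f g (c₀, b₀)) :
    x₀ ∈ levelSetMap f g c₀ (f x₀ + inner ℝ c₀ x₀, b₀) :=
  ⟨le_rfl, hx₀.1⟩

variable [CompactSpace T]

/-- The supremum is taken over a nonempty bounded set, so its bounds can be checked termwise. -/
theorem supFunction_le_iff (hcont : Continuous fun p : T × EuclideanSpace ℝ (Fin n) => g p.1 p.2)
    {x : EuclideanSpace ℝ (Fin n)} {r : ℝ} :
    supFunction f g c₀ b₀ x₀ x ≤ r ↔
      f x + inner ℝ c₀ x ≤ f x₀ + inner ℝ c₀ x₀ + r ∧ ∀ t, g t x ≤ b₀ t + r := by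
  have hbdd : BddAbove (range fun t => g t x - b₀ t) :=
    (isCompact_range ((hcont.comp (by fun_prop : Continuous fun t => (t, x))).sub
      b₀.continuous)).bddAbove
  rw [supFunction, csSup_le_iff (hbdd.insert _) (insert_nonempty _ _), forall_mem_insert,
    forall_mem_range, inner_sub_right]
  refine and_congr ⟨fun h => by linarith, fun h => by linarith⟩ (forall_congr' fun t => ?_)
  exact ⟨fun h => by linarith, fun h => by linarith⟩

theorem setOf_supFunction_nonpos
    (hcont : Continuous fun p : T × EuclideanSpace ℝ (Fin n) => g p.1 p.2) :
    {x | supFunction f g c₀ b₀ x₀ x ≤ 0} = levelSetMap f g c₀ (f x₀ + inner ℝ c₀ x₀, b₀) := by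
  ext x
  simp [supFunction_le_iff hcont, levelSetMap]

theorem apply_le_add_dist (b b' : C(T, ℝ)) (t : T) : b t ≤ b' t + dist b b' := by
  have := (le_abs_self _).trans ((Real.dist_eq (b t) (b' t)).symm.trans_le
    (ContinuousMap.dist_apply_le_dist t))
  linarith

theorem supFunction_le_dist_of_mem_levelSetMap
    (hcont : Continuous fun p : T × EuclideanSpace ℝ (Fin n) => g p.1 p.2)
    {x : EuclideanSpace ℝ (Fin n)} {p : ℝ × C(T, ℝ)} (hx : x ∈ levelSetMap f g c₀ p) :
    supFunction f g c₀ b₀ x₀ x ≤ dist p (f x₀ + inner ℝ c₀ x₀, b₀) := by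
  obtain ⟨α, b⟩ := p
  have h1 : dist α (f x₀ + inner ℝ c₀ x₀) ≤ dist (α, b) (f x₀ + inner ℝ c₀ x₀, b₀) :=
    le_max_left _ _
  have h2 : dist b b₀ ≤ dist (α, b) (f x₀ + inner ℝ c₀ x₀, b₀) := le_max_right _ _
  refine (supFunction_le_iff hcont).2 ⟨?_, fun t => ?_⟩
  · have := le_abs_self (α - (f x₀ + inner ℝ c₀ x₀))
    rw [← Real.dist_eq] at this
    linarith [hx.1]
  · linarith [hx.2 t, apply_le_add_dist b b₀ t]

/-- Uniformity in `t ∈ T` comes from currying `g` to a continuous map into `C(T, ℝ)`. -/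
theorem eventually_supFunction_le
    (hcont : Continuous fun p : T × EuclideanSpace ℝ (Fin n) => g p.1 p.2)
    (hf : Continuous f) (hx₀ : x₀ ∈ feasibleSet g b₀) {ε : ℝ} (hε : 0 < ε) :
    ∀ᶠ x in 𝓝 x₀, supFunction f g c₀ b₀ x₀ x ≤ ε := by
  let G : C(EuclideanSpace ℝ (Fin n), C(T, ℝ)) :=
    ContinuousMap.curry ⟨fun p : EuclideanSpace ℝ (Fin n) × T => g p.2 p.1,
      hcont.comp continuous_swap⟩
  have hG : ∀ᶠ x in 𝓝 x₀, dist (G x) (G x₀) < ε :=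
    G.continuous.continuousAt (Metric.ball_mem_nhds _ hε)
  have hF : ∀ᶠ x in 𝓝 x₀, f x + inner ℝ c₀ x < f x₀ + inner ℝ c₀ x₀ + ε :=
    (by fun_prop : Continuous fun x => f x + inner ℝ c₀ x).continuousAt.eventually_lt_const
      (by linarith)
  filter_upwards [hG, hF] with x h1 h2
  refine (supFunction_le_iff hcont).2 ⟨h2.le, fun t => ?_⟩
  have h3 : g t x ≤ g t x₀ + dist (G x) (G x₀) := apply_le_add_dist (G x) (G x₀) t
  linarith [hx₀ t]

/-! ### Calmness of level sets and error bounds -/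

theorem isOrderCalm_levelSetMap_iff
    (hcont : Continuous fun p : T × EuclideanSpace ℝ (Fin n) => g p.1 p.2)
    (hf : Continuous f) (hq0 : 0 < q) (hx₀ : x₀ ∈ solutionMap f g (c₀, b₀)) :
    IsOrderCalm q (levelSetMap f g c₀) (f x₀ + inner ℝ c₀ x₀, b₀) x₀ ↔
      HasOrderErrorBound q (supFunction f g c₀ b₀ x₀) x₀ := by
  have hmem := mem_levelSetMap_of_mem_solutionMap hx₀
  rw [IsOrderCalm, HasOrderErrorBound, setOf_supFunction_nonpos hcont]
  refine and_congr ?_ (exists_congr fun τ => and_congr_right fun hτ => ?_)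
  · rw [← setOf_supFunction_nonpos hcont]
    rfl
  constructor
  · rintro ⟨U, hU, V, hV, h⟩
    obtain ⟨ε, hε, hεV⟩ := Metric.mem_nhds_iff.1 hV
    obtain ⟨δ, hδ, hball⟩ := Metric.mem_nhds_iff.1 (inter_mem hU
      (eventually_supFunction_le (f := f) (c₀ := c₀) hcont hf hx₀.1 (half_pos hε)))
    refine ⟨δ, hδ, fun x hx => ?_⟩
    obtain ⟨hxU, hxε⟩ := hball hx
    set r := max (supFunction f g c₀ b₀ x₀ x) 0 with hr
    have hr0 : 0 ≤ r := le_max_right _ _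
    have hrε : r ≤ ε / 2 := max_le hxε (by positivity)
    set p : ℝ × C(T, ℝ) := (f x₀ + inner ℝ c₀ x₀ + r, b₀ + ContinuousMap.const T r) with hp
    have hdist : dist p (f x₀ + inner ℝ c₀ x₀, b₀) ≤ r := by
      refine max_le ?_ ((ContinuousMap.dist_le hr0).2 fun t => ?_)
      · simp [hp, abs_of_nonneg hr0]
      · simp [hp, abs_of_nonneg hr0]
    have hxp : x ∈ levelSetMap f g c₀ p :=
      (supFunction_le_iff (f := f) (x₀ := x₀) hcont).1 (le_max_left _ 0)
    calc τ * Metric.infDist x (levelSetMap f g c₀ (f x₀ + inner ℝ c₀ x₀, b₀))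
        ≤ dist p (f x₀ + inner ℝ c₀ x₀, b₀) ^ q :=
          h p (hεV (Metric.mem_ball.2 (by linarith))) x ⟨hxp, hxU⟩
      _ ≤ r ^ q := Real.rpow_le_rpow dist_nonneg hdist hq0.le
  · rintro ⟨δ, hδ, h⟩
    refine ⟨Metric.ball x₀ δ, Metric.ball_mem_nhds _ hδ, univ, univ_mem, ?_⟩
    rintro p - x ⟨hxp, hxδ⟩
    exact (h x hxδ).trans (Real.rpow_le_rpow (le_max_right _ _)
      (max_le (supFunction_le_dist_of_mem_levelSetMap hcont hxp) dist_nonneg) hq0.le)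

/-! ### From the error bound to calmness of the solution mapping -/

theorem exists_uniform_slater (hcont : Continuous fun p : T × EuclideanSpace ℝ (Fin n) => g p.1 p.2)
    (hS : SlaterCondition g b₀) : ∃ z, ∃ ρ > 0, ∀ t, g t z + ρ ≤ b₀ t := by
  obtain ⟨z, hz⟩ := hS
  rcases isEmpty_or_nonempty T with hT | hT
  · exact ⟨z, 1, one_pos, fun t => hT.elim t⟩
  have hc : Continuous fun t => b₀ t - g t z :=
    b₀.continuous.sub (hcont.comp (by fun_prop : Continuous fun t => (t, z)))
  obtain ⟨t₀, -, ht₀⟩ := isCompact_univ.exists_isMinOn univ_nonempty hc.continuousOn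
  refine ⟨z, b₀ t₀ - g t₀ z, sub_pos.2 (hz t₀), fun t => ?_⟩
  have : b₀ t₀ - g t₀ z ≤ b₀ t - g t z := ht₀ (mem_univ t)
  linarith

/-- Solutions of the perturbed problem near `x₀` nearly satisfy the inequalities defining the
reference solution set, with an error linear in the perturbation. -/
theorem exists_supFunction_le_of_mem_solutionMap
    (hcont : Continuous fun p : T × EuclideanSpace ℝ (Fin n) => g p.1 p.2)
    (hf : ConvexOn ℝ univ f) (hg : ∀ t, ConvexOn ℝ univ (g t))
    (hx₀ : x₀ ∈ feasibleSet g b₀) (hS : SlaterCondition g b₀) :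
    ∃ κ ≥ 0, ∀ᶠ p in 𝓝 (c₀, b₀), ∀ x ∈ solutionMap f g p ∩ Metric.ball x₀ 1,
      supFunction f g c₀ b₀ x₀ x ≤ κ * dist p (c₀, b₀) := by
  obtain ⟨z, ρ, hρ, hz⟩ := exists_uniform_slater hcont hS
  set M : ℝ := |f z - f x₀ + inner ℝ c₀ (z - x₀)| with hM
  refine ⟨1 + M / ρ + (‖z - x₀‖ + 1), by positivity, ?_⟩
  filter_upwards [Metric.ball_mem_nhds (c₀, b₀) hρ]
  rintro ⟨c, b⟩ hp x ⟨hx, hxball⟩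
  set d := dist (c, b) (c₀, b₀) with hd
  have hd0 : 0 ≤ d := dist_nonneg
  have hdρ : d < ρ := hp
  have hcd : ‖c - c₀‖ ≤ d := by
    rw [← dist_eq_norm]
    exact le_max_left _ _
  have hbd : dist b b₀ ≤ d := le_max_right _ _
  have hκ0 : 0 ≤ M / ρ := by positivity
  -- The fraction `d / ρ` of the way to `z` restores feasibility for `b`.
  set l : ℝ := d / ρ with hl
  have hl0 : 0 ≤ l := by positivity
  have hl1 : l ≤ 1 := (div_le_one hρ).2 hdρ.le
  have hlρ : l * ρ = d := div_mul_cancel₀ _ hρ.ne'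
  set y := (1 - l) • x₀ + l • z with hy
  have hyx : y - x₀ = l • (z - x₀) := by rw [hy]; module
  have hyfeas : y ∈ feasibleSet g b := fun t => by
    have h1 := (hg t).2 (mem_univ x₀) (mem_univ z) (sub_nonneg.2 hl1) hl0 (by ring)
    simp only [smul_eq_mul] at h1
    have h2 := apply_le_add_dist b₀ b t
    rw [dist_comm] at h2
    nlinarith [mul_le_mul_of_nonneg_left (hx₀ t) (sub_nonneg.2 hl1),
      mul_le_mul_of_nonneg_left (hz t) hl0]
  have hfy := hf.2 (mem_univ x₀) (mem_univ z) (sub_nonneg.2 hl1) hl0 (by ring)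
  simp only [smul_eq_mul] at hfy
  have hopt : f x + inner ℝ c x ≤ f y + inner ℝ c y := hx.2 y hyfeas
  have hin : inner ℝ (c - c₀) (y - x) ≤ d * (‖z - x₀‖ + 1) := by
    refine (real_inner_le_norm _ _).trans (mul_le_mul hcd ?_ (norm_nonneg _) hd0)
    have h1 : y - x = l • (z - x₀) + (x₀ - x) := by rw [← hyx]; abel
    have h2 : ‖x₀ - x‖ ≤ 1 := by
      rw [← dist_eq_norm, dist_comm]
      exact (Metric.mem_ball.1 hxball).le
    rw [h1]
    refine (norm_add_le _ _).trans (add_le_add ?_ h2)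
    rw [norm_smul, Real.norm_of_nonneg hl0]
    exact mul_le_of_le_one_left (norm_nonneg _) hl1
  have hcy : inner ℝ c₀ y - inner ℝ c₀ x₀ = l * inner ℝ c₀ (z - x₀) := by
    rw [← inner_sub_right, hyx, inner_smul_right]
  have hlM : l * (f z - f x₀ + inner ℝ c₀ (z - x₀)) ≤ M / ρ * d := by
    refine (mul_le_mul_of_nonneg_left (le_abs_self _) hl0).trans_eq ?_
    rw [← hM, hl]
    ring
  rw [inner_sub_left, inner_sub_right, inner_sub_right] at hin
  have hN : 0 ≤ ‖z - x₀‖ := norm_nonneg _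
  refine (supFunction_le_iff hcont).2 ⟨by nlinarith, fun t => ?_⟩
  have h1 : g t x ≤ b t := hx.1 t
  nlinarith [apply_le_add_dist b b₀ t, mul_nonneg hκ0 hd0, mul_nonneg hN hd0]

theorem isOrderCalm_solutionMap_of_hasOrderErrorBound
    (hcont : Continuous fun p : T × EuclideanSpace ℝ (Fin n) => g p.1 p.2)
    (hf : ConvexOn ℝ univ f) (hg : ∀ t, ConvexOn ℝ univ (g t)) (hq0 : 0 < q)
    (hx₀ : x₀ ∈ solutionMap f g (c₀, b₀)) (hS : SlaterCondition g b₀)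
    (h : HasOrderErrorBound q (supFunction f g c₀ b₀ x₀) x₀) :
    IsOrderCalm q (solutionMap f g) (c₀, b₀) x₀ := by
  obtain ⟨-, τ, hτ, δ, hδ, h⟩ := h
  rw [setOf_supFunction_nonpos hcont, levelSetMap_eq_solutionMap hx₀] at h
  obtain ⟨κ, hκ, hev⟩ := exists_supFunction_le_of_mem_solutionMap (c₀ := c₀) hcont hf hg hx₀.1 hS
  -- Passing to `κ + 1` makes the constant positive.
  have hκ1 : 0 < (κ + 1) ^ q := by positivity
  refine ⟨hx₀, τ / (κ + 1) ^ q, by positivity, Metric.ball x₀ (min δ 1),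
    Metric.ball_mem_nhds _ (by positivity), _, hev, fun p hp x hx => ?_⟩
  have hsup := hp x ⟨hx.1, Metric.ball_subset_ball (min_le_right _ _) hx.2⟩
  have hd0 : 0 ≤ dist p (c₀, b₀) := dist_nonneg
  have hmax : max (supFunction f g c₀ b₀ x₀ x) 0 ≤ (κ + 1) * dist p (c₀, b₀) :=
    max_le (by linarith) (by positivity)
  rw [div_mul_eq_mul_div, div_le_iff₀ hκ1]
  calc τ * Metric.infDist x (solutionMap f g (c₀, b₀))
      ≤ max (supFunction f g c₀ b₀ x₀ x) 0 ^ q :=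
        h x (Metric.ball_subset_ball (min_le_left _ _) hx.2)
    _ ≤ ((κ + 1) * dist p (c₀, b₀)) ^ q :=
        Real.rpow_le_rpow (le_max_right _ _) hmax hq0.le
    _ = dist p (c₀, b₀) ^ q * (κ + 1) ^ q := by
        rw [Real.mul_rpow (by positivity) hd0, mul_comm]

theorem isOrderCalm_partialSolutionMap_of_solutionMap
    (h : IsOrderCalm q (solutionMap f g) (c₀, b₀) x₀) :
    IsOrderCalm q (partialSolutionMap f g c₀) b₀ x₀ := by
  obtain ⟨hx₀, τ, hτ, U, hU, V, hV, h⟩ := h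
  have hc : ContinuousAt (fun b : C(T, ℝ) => (c₀, b)) b₀ := by fun_prop
  refine ⟨hx₀, τ, hτ, U, hU, _, hc hV, fun b hb x hx => (h _ hb x hx).trans_eq ?_⟩
  rw [Prod.dist_eq, dist_self, max_eq_right dist_nonneg]

/-! ### Linear data -/

/-- For linear data a solution has Lagrange multipliers, supported on the active constraints. -/
theorem exists_lagrange_multipliers
    (hcont : Continuous fun p : T × EuclideanSpace ℝ (Fin n) => g p.1 p.2)
    (hf : IsLinearMap ℝ f) (hg : ∀ t, IsLinearMap ℝ (g t))
    (hx₀ : x₀ ∈ solutionMap f g (c₀, b₀)) (hS : SlaterCondition g b₀) :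
    ∃ (ι : Type) (_ : Fintype ι) (w : ι → ℝ) (p : ι → T), (∀ i, 0 ≤ w i) ∧
      (∀ i, w i * (b₀ (p i) - g (p i) x₀) = 0) ∧
      ∀ x, f x + inner ℝ c₀ x + ∑ i, w i * g (p i) x = 0 := by
  obtain ⟨a, ha, hga⟩ := exists_gradient hcont hg
  obtain ⟨z, hz⟩ := hS
  obtain ⟨u, hu⟩ : ∃ u, ∀ x, f x = inner ℝ u x :=
    ⟨(InnerProductSpace.toDual ℝ _).symm (LinearMap.toContinuousLinearMap (IsLinearMap.mk' f hf)),
      fun x => by rw [InnerProductSpace.toDual_symm_apply]; rfl⟩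
  obtain ⟨ι, hι, w, p, hw, hws, hsum⟩ := exists_multipliers (a := a)
    (s := fun t => b₀ t - g t x₀) (c := u + c₀) (z := z - x₀) ha
    (b₀.continuous.sub (hcont.comp (by fun_prop : Continuous fun t => (t, x₀))))
    (fun t => sub_nonneg.2 (hx₀.1 t))
    (fun d hd => by
      have := hx₀.2 (x₀ + d) fun t => by
        have := hd t
        rw [hga, inner_add_right, ← hga]
        linarith
      simp only [hu, inner_add_right, inner_add_left] at this ⊢
      linarith)
    (fun t => by
      rw [inner_sub_right, ← hga, ← hga]
      linarith [hz t])
  refine ⟨ι, hι, w, p, hw, hws, fun x => ?_⟩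
  have := hsum x
  rw [inner_add_left, ← hu] at this
  simpa only [hga] using this

theorem isOrderCalm_levelSetMap_of_partialSolutionMap
    (hcont : Continuous fun p : T × EuclideanSpace ℝ (Fin n) => g p.1 p.2)
    (hf : IsLinearMap ℝ f) (hg : ∀ t, IsLinearMap ℝ (g t)) (hq0 : 0 < q)
    (hx₀ : x₀ ∈ solutionMap f g (c₀, b₀)) (hS : SlaterCondition g b₀)
    (h : IsOrderCalm q (partialSolutionMap f g c₀) b₀ x₀) :
    IsOrderCalm q (levelSetMap f g c₀) (f x₀ + inner ℝ c₀ x₀, b₀) x₀ := by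
  obtain ⟨ι, _, w, p, hw, hws, hsum⟩ := exists_lagrange_multipliers hcont hf hg hx₀ hS
  obtain ⟨-, τ, hτ, U, hU, V, hV, h⟩ := h
  obtain ⟨ε, hε, hεV⟩ := Metric.mem_nhds_iff.1 hV
  -- The inverse of a vanishing weight is zero, so only the support of `w` contributes to `κ`.
  set κ : ℝ := 1 + (1 + ∑ i, w i) * ∑ i, (w i)⁻¹ with hκ
  have hW : 0 ≤ ∑ i, w i := Finset.sum_nonneg fun i _ => hw i
  have hWi : 0 ≤ ∑ i, (w i)⁻¹ := Finset.sum_nonneg fun i _ => inv_nonneg.2 (hw i)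
  have hκ1 : 1 ≤ κ := by
    have : 0 ≤ (1 + ∑ i, w i) * ∑ i, (w i)⁻¹ := by positivity
    linarith
  have hκ0 : 0 < κ := by linarith
  have hκq : 0 < κ ^ q := by positivity
  refine ⟨mem_levelSetMap_of_mem_solutionMap hx₀, τ / κ ^ q, by positivity, U, hU,
    Metric.ball (f x₀ + inner ℝ c₀ x₀, b₀) (ε / κ), Metric.ball_mem_nhds _ (by positivity), ?_⟩
  intro y hy x hx
  set d := dist y (f x₀ + inner ℝ c₀ x₀, b₀) with hd
  have hd0 : 0 ≤ d := dist_nonneg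
  have hdε : κ * d < ε := by
    rw [mul_comm, ← lt_div_iff₀ hκ0]
    exact hy
  obtain ⟨hobj, hcon⟩ := (supFunction_le_iff hcont).1
    (supFunction_le_dist_of_mem_levelSetMap (b₀ := b₀) (x₀ := x₀) hcont hx.1)
  rw [← hd] at hobj hcon
  have hxt : Continuous fun t => g t x := hcont.comp (by fun_prop : Continuous fun t => (t, x))
  let b' : C(T, ℝ) := ⟨fun t => b₀ t + max (g t x - b₀ t) (-(κ * d)),
    b₀.continuous.add ((hxt.sub b₀.continuous).max continuous_const)⟩
  have hdist : dist b' b₀ ≤ κ * d := by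
    refine (ContinuousMap.dist_le (by positivity)).2 fun t => ?_
    have h1 : b' t - b₀ t = max (g t x - b₀ t) (-(κ * d)) := add_sub_cancel_left _ _
    rw [Real.dist_eq, h1, abs_le]
    refine ⟨le_max_right _ _, max_le ?_ ?_⟩ <;> nlinarith [hcon t]
  -- On the support of `w` the constraint values at `x` cannot drop far below `b₀`: the weighted sum
  -- of the residuals is at least `-d`, while each residual is at most `d`.
  have hlow (i : ι) (hi : w i ≠ 0) : -(κ * d) ≤ g (p i) x - b₀ (p i) := by
    have hwi : 0 < w i := (hw i).lt_of_ne' hi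
    have h1 : ∑ j, w j * (d - (g (p j) x - b₀ (p j))) ≤ (1 + ∑ j, w j) * d := by
      have h2 : ∑ j, w j * b₀ (p j) = ∑ j, w j * g (p j) x₀ :=
        Finset.sum_congr rfl fun j _ => by linarith [hws j]
      simp only [mul_sub, Finset.sum_sub_distrib, h2, ← Finset.sum_mul]
      linarith [hsum x, hsum x₀]
    have h3 : w i * (d - (g (p i) x - b₀ (p i))) ≤ (1 + ∑ j, w j) * d :=
      (Finset.single_le_sum (f := fun j => w j * (d - (g (p j) x - b₀ (p j))))
        (fun j _ => mul_nonneg (hw j) (by linarith [hcon (p j)])) (Finset.mem_univ i)).trans h1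
    have h4 : (w i)⁻¹ ≤ ∑ j, (w j)⁻¹ :=
      Finset.single_le_sum (f := fun j => (w j)⁻¹) (fun j _ => inv_nonneg.2 (hw j))
        (Finset.mem_univ i)
    have h5 : d - (g (p i) x - b₀ (p i)) ≤ (w i)⁻¹ * ((1 + ∑ j, w j) * d) := by
      rwa [← div_eq_inv_mul, le_div_iff₀' hwi]
    have h6 : (w i)⁻¹ * ((1 + ∑ j, w j) * d) ≤ (∑ j, (w j)⁻¹) * ((1 + ∑ j, w j) * d) :=
      mul_le_mul_of_nonneg_right h4 (by positivity)
    have h7 : κ * d = d + (∑ j, (w j)⁻¹) * ((1 + ∑ j, w j) * d) := by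
      rw [hκ]
      ring
    linarith
  have hxb' : x ∈ partialSolutionMap f g c₀ b' := by
    refine ⟨fun t => ?_, fun v hv => ?_⟩
    · have h1 : b₀ t + (g t x - b₀ t) ≤ b' t := add_le_add_right (le_max_left _ _) _
      linarith
    · have h1 : ∑ i, w i * g (p i) v ≤ ∑ i, w i * g (p i) x := by
        refine Finset.sum_le_sum fun i _ => ?_
        by_cases hi : w i = 0
        · simp [hi]
        · have h2 : b' (p i) = g (p i) x := by
            change b₀ (p i) + max (g (p i) x - b₀ (p i)) (-(κ * d)) = _
            rw [max_eq_left (hlow i hi)]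
            ring
          exact mul_le_mul_of_nonneg_left ((hv (p i)).trans_eq h2) (hw i)
      linarith [hsum v, hsum x]
  rw [levelSetMap_eq_solutionMap hx₀, div_mul_eq_mul_div, div_le_iff₀ hκq]
  calc τ * Metric.infDist x (solutionMap f g (c₀, b₀))
      ≤ dist b' b₀ ^ q := h b' (hεV (hdist.trans_lt hdε)) x ⟨hxb', hx.2⟩
    _ ≤ (κ * d) ^ q := Real.rpow_le_rpow dist_nonneg hdist hq0.le
    _ = d ^ q * κ ^ q := by rw [Real.mul_rpow hκ0.le hd0, mul_comm]

end

end HolderCalm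

theorem mainTheorem9 {n : ℕ} {T : Type*} [MetricSpace T] [CompactSpace T]
    (f : EuclideanSpace ℝ (Fin n) → ℝ) (g : T → EuclideanSpace ℝ (Fin n) → ℝ)
    (hf : ConvexOn ℝ Set.univ f) (hg : ∀ t, ConvexOn ℝ Set.univ (g t))
    (hcont : Continuous fun p : T × EuclideanSpace ℝ (Fin n) => g p.1 p.2)
    (q : ℝ) (hq0 : 0 < q) (hq1 : q ≤ 1)
    (c₀ : EuclideanSpace ℝ (Fin n)) (b₀ : C(T, ℝ)) (x₀ : EuclideanSpace ℝ (Fin n))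
    (hx₀ : x₀ ∈ HolderCalm.solutionMap f g (c₀, b₀))
    (hSlater : HolderCalm.SlaterCondition g b₀) :
    ((HolderCalm.IsOrderCalm q (HolderCalm.levelSetMap f g c₀) (f x₀ + inner ℝ c₀ x₀, b₀) x₀ ↔
        HolderCalm.HasOrderErrorBound q (HolderCalm.supFunction f g c₀ b₀ x₀) x₀) ∧
      (HolderCalm.HasOrderErrorBound q (HolderCalm.supFunction f g c₀ b₀ x₀) x₀ →
        HolderCalm.IsOrderCalm q (HolderCalm.solutionMap f g) (c₀, b₀) x₀) ∧
      (HolderCalm.IsOrderCalm q (HolderCalm.solutionMap f g) (c₀, b₀) x₀ →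
        HolderCalm.IsOrderCalm q (HolderCalm.partialSolutionMap f g c₀) b₀ x₀)) ∧
    (IsLinearMap ℝ f → (∀ t, IsLinearMap ℝ (g t)) →
      List.TFAE [
        HolderCalm.IsOrderCalm q (HolderCalm.solutionMap f g) (c₀, b₀) x₀,
        HolderCalm.IsOrderCalm q (HolderCalm.partialSolutionMap f g c₀) b₀ x₀,
        HolderCalm.IsOrderCalm q (HolderCalm.levelSetMap f g c₀) (f x₀ + inner ℝ c₀ x₀, b₀) x₀,
        HolderCalm.HasOrderErrorBound q (HolderCalm.supFunction f g c₀ b₀ x₀) x₀]) := by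
  have hfc : Continuous f := hf.locallyLipschitz.continuous
  have h34 := HolderCalm.isOrderCalm_levelSetMap_iff (q := q) hcont hfc hq0 hx₀
  have h41 := HolderCalm.isOrderCalm_solutionMap_of_hasOrderErrorBound hcont hf hg hq0 hx₀ hSlater
  have h12 := HolderCalm.isOrderCalm_partialSolutionMap_of_solutionMap
    (q := q) (f := f) (g := g) (c₀ := c₀) (b₀ := b₀) (x₀ := x₀)
  refine ⟨⟨h34, h41, h12⟩, fun hfl hgl => ?_⟩
  have h23 := HolderCalm.isOrderCalm_levelSetMap_of_partialSolutionMap hcont hfl hgl hq0 hx₀ hSlater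
  tfae_have 1 → 2 := h12
  tfae_have 2 → 3 := h23
  tfae_have 3 → 4 := h34.1
  tfae_have 4 → 1 := h41
  tfae_finish
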